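/- Let $H=-\frac{d^2}{dx^2}+i\,\mathrm{sgn}(x)$ in $L^2(\mathbb{R})$, $\mathrm{Dom}(H)=W^{2,2}(\mathbb{R})$, which is the operator associated with the sesquilinear form $$h(\psi,\phi)=\int_{\mathbb{R}}\psi'\overline{\phi'}\,dx+i\int_0^{\infty}\psi\overline{\phi}\,dx-i\int_{-\infty}^0\psi\overline{\phi}\,dx,\qquad \mathrm{Dom}(h)=W^{1,2}(\mathbb{R}).$$ For a complex-valued $V\in L^1(\mathbb{R})$ and $\varepsilon\in\mathbb{R}$, let $H_\varepsilon=H\,\dot{+}\,\varepsilon V$ be the operator in $L^2(\mathbb{R})$ associated with the form $h+\varepsilon v$, where $v(\psi,\phi)=\int_{\mathbb{R}}V\psi\overline{\phi}\,dx$ on $\mathrm{Dom}(v)=\{\psi\in L^2(\mathbb{R}):|V|^{1/2}\psi\in L^2(\mathbb{R})\}$. That is, $\psi\in\mathrm{Dom}(h)\cap\mathrm{Dom}(v)$ belongs to $\mathrm{Dom}(H_\varepsilon)$ and $H_\varepsilon\psi=\eta\in L^2(\mathbb{R})$ if and only if $(h+\varepsilon v)(\psi,\phi)=(\eta,\phi)$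 for all $\phi\in\mathrm{Dom}(h)\cap\mathrm{Dom}(v)$. Let $\sigma_{\mathrm p}(H_\varepsilon)$ be the set of eigenvalues of $H_\varepsilon$ and $\mathcal{S}=[0,\infty)+i(-1,1)$. There exist universal constants $C_1,C_2>0$ (independent of $V$ and $\varepsilon$) such that, for every $V\in L^1(\mathbb{R},(1+x^2)\,dx)$ and every $\varepsilon\in\mathbb{R}$ with $$|\varepsilon|\,\big\|(1+|\cdot|^2)V\big\|_{L^1(\mathbb{R})}\le\frac1{C_1},$$ we have $$\sigma_{\mathrm p}(H_\varepsilon)\subset\overline{\mathcal{S}}\cap\Big\{z\in\mathbb{C}:\ \mathrm{Re}\,z\ge\frac{C_2}{\varepsilon^2\|V\|_{L^1(\mathbb{R})}^2}\Big\},$$ where the right-hand side is read as the empty set if $\varepsilon\|V\|_{L^1(\mathbb{R})}=0$. -/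

import Mathlib

open MeasureTheory Complex
open scoped ContDiff ComplexConjugate

noncomputable section

namespace HalfLineStep

/-! ### Sesquilinear forms and the operators associated with them -/

/-- A sesquilinear form in a complex Hilbert space: it is linear
in the first and conjugate-linear in the second argument. -/
structure SesqForm (E : Type*) [NormedAddCommGroup E] [InnerProductSpace ℂ E] where
  /-- The form domain. -/
  dom : Submodule ℂ E
  /-- The form itself. -/
  form : dom →ₗ[ℂ] dom →ₗ⋆[ℂ] ℂ

namespace SesqForm

variable {E : Type*} [NormedAddCommGroup E] [InnerProductSpace ℂ E]

/-- The sum of two forms, on the intersection of the two domains. -/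
def add (s t : SesqForm E) : SesqForm E where
  dom := s.dom ⊓ t.dom
  form := LinearMap.mk₂'ₛₗ (RingHom.id ℂ) (starRingEnd ℂ)
    (fun ψ φ => s.form ⟨ψ, ψ.2.1⟩ ⟨φ, φ.2.1⟩ + t.form ⟨ψ, ψ.2.2⟩ ⟨φ, φ.2.2⟩)
    (fun ψ₁ ψ₂ φ => by
      have h1 : s.form ⟨(ψ₁ + ψ₂ : E), (ψ₁ + ψ₂).2.1⟩ =
          s.form ⟨ψ₁, ψ₁.2.1⟩ + s.form ⟨ψ₂, ψ₂.2.1⟩ := by rw [← map_add]; rfl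
      have h2 : t.form ⟨(ψ₁ + ψ₂ : E), (ψ₁ + ψ₂).2.2⟩ =
          t.form ⟨ψ₁, ψ₁.2.2⟩ + t.form ⟨ψ₂, ψ₂.2.2⟩ := by rw [← map_add]; rfl
      simp only [Submodule.coe_add, h1, h2, LinearMap.add_apply]; ring)
    (fun c ψ φ => by
      have h1 : s.form ⟨(c • ψ : E), (c • ψ).2.1⟩ = c • s.form ⟨ψ, ψ.2.1⟩ := by
        rw [← map_smul]; rfl
      have h2 : t.form ⟨(c • ψ : E), (c • ψ).2.2⟩ = c • t.form ⟨ψ, ψ.2.2⟩ := by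
        rw [← map_smul]; rfl
      simp only [Submodule.coe_smul, h1, h2, LinearMap.smul_apply, smul_eq_mul,
        RingHom.id_apply]; ring)
    (fun ψ φ₁ φ₂ => by
      have h1 : s.form ⟨ψ, ψ.2.1⟩ ⟨(φ₁ + φ₂ : E), (φ₁ + φ₂).2.1⟩ =
          s.form ⟨ψ, ψ.2.1⟩ ⟨φ₁, φ₁.2.1⟩ + s.form ⟨ψ, ψ.2.1⟩ ⟨φ₂, φ₂.2.1⟩ := by
        rw [← map_add]; rfl
      have h2 : t.form ⟨ψ, ψ.2.2⟩ ⟨(φ₁ + φ₂ : E), (φ₁ + φ₂).2.2⟩ =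
          t.form ⟨ψ, ψ.2.2⟩ ⟨φ₁, φ₁.2.2⟩ + t.form ⟨ψ, ψ.2.2⟩ ⟨φ₂, φ₂.2.2⟩ := by
        rw [← map_add]; rfl
      simp only [Submodule.coe_add, h1, h2]; ring)
    (fun c ψ φ => by
      have h1 : s.form ⟨ψ, ψ.2.1⟩ ⟨(c • φ : E), (c • φ).2.1⟩ =
          conj c * s.form ⟨ψ, ψ.2.1⟩ ⟨φ, φ.2.1⟩ := by
        rw [← smul_eq_mul, ← LinearMap.map_smulₛₗ]; rfl
      have h2 : t.form ⟨ψ, ψ.2.2⟩ ⟨(c • φ : E), (c • φ).2.2⟩ =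
          conj c * t.form ⟨ψ, ψ.2.2⟩ ⟨φ, φ.2.2⟩ := by
        rw [← smul_eq_mul, ← LinearMap.map_smulₛₗ]; rfl
      simp only [Submodule.coe_smul, h1, h2, smul_eq_mul]; ring)

/-- A scalar multiple of a form, with the same domain. -/
def smul (c : ℂ) (t : SesqForm E) : SesqForm E where
  dom := t.dom
  form := c • t.form

/-- The domain of the operator associated with a form `t` (in the sense of the representation
theorem): all `ψ ∈ Dom t` for which there is `η` in the Hilbert space with `t(ψ, φ) = (η, φ)` for
all `φ ∈ Dom t`. (The inner product of Mathlib is linear in its second argument.) -/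
def operatorDom (t : SesqForm E) : Submodule ℂ E where
  carrier := {ψ | ∃ hψ : ψ ∈ t.dom, ∃ η : E, ∀ φ : t.dom,
    t.form ⟨ψ, hψ⟩ φ = inner ℂ (φ : E) η}
  zero_mem' := ⟨t.dom.zero_mem, 0, fun φ => by
    have : (⟨0, t.dom.zero_mem⟩ : t.dom) = 0 := rfl
    simp [this]⟩
  add_mem' := by
    rintro ψ₁ ψ₂ ⟨h₁, η₁, e₁⟩ ⟨h₂, η₂, e₂⟩
    refine ⟨t.dom.add_mem h₁ h₂, η₁ + η₂, fun φ => ?_⟩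
    have : (⟨ψ₁ + ψ₂, t.dom.add_mem h₁ h₂⟩ : t.dom) = ⟨ψ₁, h₁⟩ + ⟨ψ₂, h₂⟩ := rfl
    rw [this, map_add, LinearMap.add_apply, e₁, e₂, inner_add_right]
  smul_mem' := by
    rintro c ψ ⟨h, η, e⟩
    refine ⟨t.dom.smul_mem c h, c • η, fun φ => ?_⟩
    have : (⟨c • ψ, t.dom.smul_mem c h⟩ : t.dom) = c • ⟨ψ, h⟩ := rfl
    rw [this, map_smul, LinearMap.smul_apply, e, inner_smul_right, smul_eq_mul]

theorem mem_dom_of_mem_operatorDom {t : SesqForm E} (ψ : t.operatorDom) : (ψ : E) ∈ t.dom :=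
  ψ.2.choose

/-- The vector `η` with `t(ψ, φ) = (η, φ)` for all `φ ∈ Dom t`; it is unique if `Dom t` is
dense. -/
def operatorVal (t : SesqForm E) (ψ : t.operatorDom) : E := ψ.2.choose_spec.choose

theorem inner_operatorVal {t : SesqForm E} (ψ : t.operatorDom) (φ : t.dom) :
    inner ℂ (φ : E) (t.operatorVal ψ) = t.form ⟨ψ, mem_dom_of_mem_operatorDom ψ⟩ φ :=
  (ψ.2.choose_spec.choose_spec φ).symm

/-- The operator associated with a densely defined form `t`: it maps `ψ` in the operator domain
to the unique `η` with `t(ψ, φ) = (η, φ)` for all `φ ∈ Dom t`. -/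
def operator (t : SesqForm E) (ht : Dense (t.dom : Set E)) : E →ₗ.[ℂ] E where
  domain := t.operatorDom
  toFun :=
    { toFun := t.operatorVal
      map_add' := fun ψ₁ ψ₂ => ht.eq_of_inner_right ℂ fun v hv => by
        have h := inner_operatorVal (ψ₁ + ψ₂) ⟨v, hv⟩
        have h₁ := inner_operatorVal ψ₁ ⟨v, hv⟩
        have h₂ := inner_operatorVal ψ₂ ⟨v, hv⟩
        have e : (⟨((ψ₁ + ψ₂ : t.operatorDom) : E), mem_dom_of_mem_operatorDom _⟩ : t.dom) =
          ⟨ψ₁, mem_dom_of_mem_operatorDom ψ₁⟩ + ⟨ψ₂, mem_dom_of_mem_operatorDom ψ₂⟩ := rfl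
        rw [e, map_add, LinearMap.add_apply, ← h₁, ← h₂] at h
        rw [inner_add_right]
        exact h
      map_smul' := fun c ψ => ht.eq_of_inner_right ℂ fun v hv => by
        have h := inner_operatorVal (c • ψ) ⟨v, hv⟩
        have h₁ := inner_operatorVal ψ ⟨v, hv⟩
        have e : (⟨((c • ψ : t.operatorDom) : E), mem_dom_of_mem_operatorDom _⟩ : t.dom) =
          c • ⟨ψ, mem_dom_of_mem_operatorDom ψ⟩ := rfl
        rw [e, map_smul, LinearMap.smul_apply, ← h₁] at h
        rw [RingHom.id_apply, inner_smul_right]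
        exact h }

end SesqForm

/-- The point spectrum (the set of eigenvalues) of an unbounded operator. -/
def pointSpectrum {E : Type*} [NormedAddCommGroup E] [InnerProductSpace ℂ E]
    (T : E →ₗ.[ℂ] E) : Set ℂ :=
  {z | ∃ ψ : T.domain, (ψ : E) ≠ 0 ∧ T ψ = z • (ψ : E)}

/-! ### The Sobolev space `W^{1,2}(ℝ)` -/

/-- The Hilbert space `L²(ℝ)` of complex-valued functions. -/
abbrev L2 : Type := Lp ℂ 2 (volume : Measure ℝ)

/-- `g` is the weak derivative of `f`: `∫ f χ' = - ∫ g χ` for all test functions `χ`. -/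
def IsWeakDeriv (f g : L2) : Prop :=
  ∀ χ : ℝ → ℝ, ContDiff ℝ ∞ χ → HasCompactSupport χ →
    ∫ x, deriv χ x • f x = - ∫ x, χ x • g x

theorem integrable_test_smul (f : L2) {χ : ℝ → ℝ} (h : Continuous χ) (hc : HasCompactSupport χ) :
    Integrable (fun x => χ x • f x) :=
  (((Lp.memLp f).locallyIntegrable (by norm_num)).integrable_smul_left_of_hasCompactSupport h hc)

theorem integrable_deriv_smul (f : L2) {χ : ℝ → ℝ} (h : ContDiff ℝ ∞ χ)
    (hc : HasCompactSupport χ) : Integrable (fun x => deriv χ x • f x) :=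
  integrable_test_smul f (h.continuous_deriv (by simp)) hc.deriv

theorem IsWeakDeriv.unique {f g g' : L2} (h : IsWeakDeriv f g) (h' : IsWeakDeriv f g') :
    g = g' := by
  apply Lp.ext
  refine ae_eq_of_integral_contDiff_smul_eq ((Lp.memLp g).locallyIntegrable (by norm_num))
    ((Lp.memLp g').locallyIntegrable (by norm_num)) fun χ h1 h2 => ?_
  have := h χ h1 h2
  rw [h' χ h1 h2] at this
  exact (neg_injective this).symm

theorem IsWeakDeriv.add {f₁ g₁ f₂ g₂ : L2} (h₁ : IsWeakDeriv f₁ g₁) (h₂ : IsWeakDeriv f₂ g₂) :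
    IsWeakDeriv (f₁ + f₂) (g₁ + g₂) := by
  intro χ hχ hc
  have e₁ : (fun x => deriv χ x • (f₁ + f₂ : L2) x) =ᵐ[volume]
      fun x => deriv χ x • f₁ x + deriv χ x • f₂ x := by
    filter_upwards [Lp.coeFn_add f₁ f₂] with x hx
    rw [hx, Pi.add_apply, smul_add]
  have e₂ : (fun x => χ x • (g₁ + g₂ : L2) x) =ᵐ[volume]
      fun x => χ x • g₁ x + χ x • g₂ x := by
    filter_upwards [Lp.coeFn_add g₁ g₂] with x hx
    rw [hx, Pi.add_apply, smul_add]
  rw [integral_congr_ae e₁, integral_congr_ae e₂,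
    integral_add (integrable_deriv_smul f₁ hχ hc) (integrable_deriv_smul f₂ hχ hc),
    integral_add (integrable_test_smul g₁ hχ.continuous hc)
      (integrable_test_smul g₂ hχ.continuous hc), h₁ χ hχ hc, h₂ χ hχ hc, neg_add]

theorem IsWeakDeriv.smul {f g : L2} (c : ℂ) (h : IsWeakDeriv f g) :
    IsWeakDeriv (c • f) (c • g) := by
  intro χ hχ hc
  have e₁ : (fun x => deriv χ x • (c • f : L2) x) =ᵐ[volume]
      fun x => c • (deriv χ x • f x) := by
    filter_upwards [Lp.coeFn_smul c f] with x hx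
    rw [hx, Pi.smul_apply, smul_comm]
  have e₂ : (fun x => χ x • (c • g : L2) x) =ᵐ[volume] fun x => c • (χ x • g x) := by
    filter_upwards [Lp.coeFn_smul c g] with x hx
    rw [hx, Pi.smul_apply, smul_comm]
  rw [integral_congr_ae e₁, integral_congr_ae e₂, integral_smul, integral_smul, h χ hχ hc,
    smul_neg]

theorem IsWeakDeriv.zero : IsWeakDeriv 0 0 := by
  have h : ∀ w : ℝ → ℝ, ∫ x, w x • (0 : L2) x = 0 := fun w => by
    rw [← integral_zero ℝ ℂ]
    apply integral_congr_ae
    filter_upwards [Lp.coeFn_zero ℂ 2 (volume : Measure ℝ)] with x hx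
    rw [hx, Pi.zero_apply, smul_zero]
  intro χ _ _
  rw [h, h, neg_zero]

/-- The Sobolev space `W^{1,2}(ℝ)`, as a subspace of `L²(ℝ)`. -/
def W12 : Submodule ℂ L2 where
  carrier := {f | ∃ g, IsWeakDeriv f g}
  zero_mem' := ⟨0, IsWeakDeriv.zero⟩
  add_mem' := fun ⟨_, h₁⟩ ⟨_, h₂⟩ => ⟨_, h₁.add h₂⟩
  smul_mem' := fun c _ ⟨_, h⟩ => ⟨_, h.smul c⟩

/-- The weak derivative `W^{1,2}(ℝ) → L²(ℝ)`. -/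
def weakDeriv : W12 →ₗ[ℂ] L2 where
  toFun f := f.2.choose
  map_add' f g := (f + g).2.choose_spec.unique (f.2.choose_spec.add g.2.choose_spec)
  map_smul' c f := (c • f).2.choose_spec.unique (f.2.choose_spec.smul c)

/-! ### The form of the unperturbed operator -/

theorem integrable_mul_conj (ψ φ : L2) : Integrable (fun x => ψ x * conj (φ x)) := by
  simpa [RCLike.inner_apply] using L2.integrable_inner (𝕜 := ℂ) φ ψ

/-- The bounded form `(ψ, φ) ↦ ∫_s ψ φ̄` in `L²(ℝ)`. -/
def setForm (s : Set ℝ) : L2 →ₗ[ℂ] L2 →ₗ⋆[ℂ] ℂ :=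
  LinearMap.mk₂'ₛₗ (RingHom.id ℂ) (starRingEnd ℂ)
    (fun ψ φ => ∫ x in s, ψ x * conj (φ x))
    (fun ψ₁ ψ₂ φ => by
      rw [← integral_add (integrable_mul_conj ψ₁ φ).integrableOn
        (integrable_mul_conj ψ₂ φ).integrableOn]
      apply integral_congr_ae
      filter_upwards [ae_restrict_of_ae (Lp.coeFn_add ψ₁ ψ₂)] with x hx
      rw [hx, Pi.add_apply, add_mul])
    (fun c ψ φ => by
      rw [RingHom.id_apply, ← integral_smul]
      apply integral_congr_ae
      filter_upwards [ae_restrict_of_ae (Lp.coeFn_smul c ψ)] with x hx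
      rw [hx, Pi.smul_apply, smul_eq_mul, smul_eq_mul, mul_assoc])
    (fun ψ φ₁ φ₂ => by
      rw [← integral_add (integrable_mul_conj ψ φ₁).integrableOn
        (integrable_mul_conj ψ φ₂).integrableOn]
      apply integral_congr_ae
      filter_upwards [ae_restrict_of_ae (Lp.coeFn_add φ₁ φ₂)] with x hx
      rw [hx, Pi.add_apply, map_add, mul_add])
    (fun c ψ φ => by
      rw [← integral_smul]
      apply integral_congr_ae
      filter_upwards [ae_restrict_of_ae (Lp.coeFn_smul c φ)] with x hx
      rw [hx, Pi.smul_apply, smul_eq_mul, smul_eq_mul, map_mul]; ring)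

/-- The form of the free Hamiltonian: `q(ψ, φ) = ∫ ψ' φ̄'` on `W^{1,2}(ℝ)`. -/
def kineticForm : W12 →ₗ[ℂ] W12 →ₗ⋆[ℂ] ℂ :=
  LinearMap.mk₂'ₛₗ (RingHom.id ℂ) (starRingEnd ℂ)
    (fun ψ φ => inner ℂ (weakDeriv φ) (weakDeriv ψ))
    (fun ψ₁ ψ₂ φ => by simp only [map_add, inner_add_right])
    (fun c ψ φ => by simp only [map_smul, inner_smul_right, RingHom.id_apply, smul_eq_mul])
    (fun ψ φ₁ φ₂ => by simp only [map_add, inner_add_left])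
    (fun c ψ φ => by simp only [map_smul, inner_smul_left, smul_eq_mul])

/-- The form `h(ψ, φ) = ∫ ψ' φ̄' + i ∫_{x > 0} ψ φ̄ - i ∫_{x < 0} ψ φ̄`, `Dom h = W^{1,2}(ℝ)`,
of the operator `H = -d²/dx² + i sgn x`. -/
def stepForm : SesqForm L2 where
  dom := W12
  form := kineticForm + (I • setForm (Set.Ioi 0) - I • setForm (Set.Iio 0)).domRestrict₁₂ W12 W12

/-! ### The form of the potential -/

theorem integrable_potential {V : ℝ → ℂ} (hV : Integrable V) {ψ φ : L2}
    (hψ : MemLp (fun x => (Real.sqrt ‖V x‖ : ℂ) * ψ x) 2)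
    (hφ : MemLp (fun x => (Real.sqrt ‖V x‖ : ℂ) * φ x) 2) :
    Integrable (fun x => V x * ψ x * conj (φ x)) := by
  have h := hψ.norm.integrable_mul hφ.norm
  refine h.mono ((hV.aestronglyMeasurable.mul (Lp.aestronglyMeasurable ψ)).mul
    (continuous_conj.comp_aestronglyMeasurable (Lp.aestronglyMeasurable φ))) (ae_of_all _ ?_)
  intro x
  have := Real.mul_self_sqrt (norm_nonneg (V x))
  simp only [norm_mul, Pi.mul_apply, norm_real, RCLike.norm_conj, Real.norm_eq_abs,
    abs_of_nonneg (Real.sqrt_nonneg _), abs_norm]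
  apply le_of_eq
  calc ‖V x‖ * ‖ψ x‖ * ‖φ x‖
      = (Real.sqrt ‖V x‖ * Real.sqrt ‖V x‖) * ‖ψ x‖ * ‖φ x‖ := by rw [this]
    _ = _ := by ring

/-- The form domain of the potential: all `ψ ∈ L²(ℝ)` with `|V|^{1/2} ψ ∈ L²(ℝ)`. -/
def potentialDom (V : ℝ → ℂ) : Submodule ℂ L2 where
  carrier := {ψ | MemLp (fun x => (Real.sqrt ‖V x‖ : ℂ) * ψ x) 2}
  zero_mem' := by
    refine (MemLp.zero (ε := ℂ) (μ := (volume : Measure ℝ))).ae_eq ?_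
    filter_upwards [Lp.coeFn_zero ℂ 2 (volume : Measure ℝ)] with x hx
    rw [hx, Pi.zero_apply, mul_zero]
  add_mem' := by
    intro ψ φ hψ hφ
    refine (MemLp.add hψ hφ).ae_eq ?_
    filter_upwards [Lp.coeFn_add ψ φ] with x hx
    rw [hx, Pi.add_apply, Pi.add_apply, mul_add]
  smul_mem' := by
    intro c ψ hψ
    refine (MemLp.const_smul hψ c).ae_eq ?_
    filter_upwards [Lp.coeFn_smul c ψ] with x hx
    rw [hx, Pi.smul_apply, Pi.smul_apply, smul_eq_mul, smul_eq_mul]; ring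

/-- The form `v(ψ, φ) = ∫ V ψ φ̄` of the operator of multiplication by `V ∈ L¹(ℝ)`. -/
def potentialForm (V : ℝ → ℂ) (hV : Integrable V) : SesqForm L2 where
  dom := potentialDom V
  form := LinearMap.mk₂'ₛₗ (RingHom.id ℂ) (starRingEnd ℂ)
    (fun ψ φ => ∫ x, V x * (ψ : L2) x * conj ((φ : L2) x))
    (fun ψ₁ ψ₂ φ => by
      rw [← integral_add (integrable_potential hV ψ₁.2 φ.2) (integrable_potential hV ψ₂.2 φ.2)]
      apply integral_congr_ae
      filter_upwards [Lp.coeFn_add (ψ₁ : L2) ψ₂] with x hx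
      rw [Submodule.coe_add, hx, Pi.add_apply]; ring)
    (fun c ψ φ => by
      rw [RingHom.id_apply, ← integral_smul]
      apply integral_congr_ae
      filter_upwards [Lp.coeFn_smul c (ψ : L2)] with x hx
      rw [Submodule.coe_smul, hx, Pi.smul_apply, smul_eq_mul, smul_eq_mul]; ring)
    (fun ψ φ₁ φ₂ => by
      rw [← integral_add (integrable_potential hV ψ.2 φ₁.2) (integrable_potential hV ψ.2 φ₂.2)]
      apply integral_congr_ae
      filter_upwards [Lp.coeFn_add (φ₁ : L2) φ₂] with x hx
      rw [Submodule.coe_add, hx, Pi.add_apply, map_add]; ring)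
    (fun c ψ φ => by
      rw [← integral_smul]
      apply integral_congr_ae
      filter_upwards [Lp.coeFn_smul c (φ : L2)] with x hx
      rw [Submodule.coe_smul, hx, Pi.smul_apply, smul_eq_mul, smul_eq_mul, map_mul]; ring)

/-! ### The perturbed operator -/

/-- The form `h_ε = h + ε v`, with domain `Dom h ∩ Dom v`. -/
def perturbedForm (V : ℝ → ℂ) (hV : Integrable V) (ε : ℝ) : SesqForm L2 :=
  stepForm.add ((potentialForm V hV).smul (ε : ℂ))

theorem dense_perturbedForm_dom (V : ℝ → ℂ) (hV : Integrable V) (ε : ℝ) :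
    Dense ((perturbedForm V hV ε).dom : Set L2) := by
  refine (Lp.dense_hasCompactSupport_contDiff (E := ℝ) (F := ℂ)
    (μ := (volume : Measure ℝ)) (p := 2) (by norm_num)).mono ?_
  rintro f ⟨g, hfg, hgc, hg⟩
  refine ⟨?_, ?_⟩
  · have hd : MemLp (deriv g) 2 (volume : Measure ℝ) :=
      (hg.continuous_deriv (by simp)).memLp_of_hasCompactSupport hgc.deriv
    refine ⟨hd.toLp, fun χ hχ hχc => ?_⟩
    have e₁ : (fun x => deriv χ x • f x) =ᵐ[volume] fun x => deriv χ x • g x := by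
      filter_upwards [hfg] with x hx
      rw [hx]
    have e₂ : (fun x => χ x • (hd.toLp : L2) x) =ᵐ[volume] fun x => χ x • deriv g x := by
      filter_upwards [hd.coeFn_toLp] with x hx
      rw [hx]
    rw [integral_congr_ae e₁, integral_congr_ae e₂]
    have cχ : Continuous (deriv χ) := hχ.continuous_deriv (by simp)
    have cg : Continuous (deriv g) := hg.continuous_deriv (by simp)
    have := integral_bilinear_hasDerivAt_right_eq_neg_left_of_integrable
      (L := ContinuousLinearMap.lsmul ℝ ℝ) (u := χ) (v := g) (u' := deriv χ) (v' := deriv g)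
      (fun x _ => ((hχ.differentiable (by simp)) x).hasDerivAt)
      (fun x _ => ((hg.differentiable (by simp)) x).hasDerivAt)
      ((hχ.continuous.smul cg).integrable_of_hasCompactSupport hχc.smul_right)
      ((cχ.smul hg.continuous).integrable_of_hasCompactSupport hgc.smul_left)
      ((hχ.continuous.smul hg.continuous).integrable_of_hasCompactSupport hχc.smul_right)
    simp only [ContinuousLinearMap.lsmul_apply] at this
    rw [this, neg_neg]
  · obtain ⟨M, hM⟩ := hgc.exists_bound_of_continuous hg.continuous
    have hs : MemLp (fun x => (Real.sqrt ‖V x‖ : ℂ)) 2 (volume : Measure ℝ) := by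
      have hm : AEStronglyMeasurable (fun x => (Real.sqrt ‖V x‖ : ℂ)) (volume : Measure ℝ) :=
        continuous_ofReal.comp_aestronglyMeasurable
          (Real.continuous_sqrt.comp_aestronglyMeasurable hV.aestronglyMeasurable.norm)
      rw [memLp_two_iff_integrable_sq_norm hm]
      simpa [Real.sq_sqrt, abs_of_nonneg (Real.sqrt_nonneg _)] using hV.norm
    have hb : MemLp (fun x => (Real.sqrt ‖V x‖ : ℂ) * g x) 2 (volume : Measure ℝ) := by
      refine (hs.norm.const_mul M).mono
        (hs.aestronglyMeasurable.mul hg.continuous.aestronglyMeasurable) (ae_of_all _ fun x => ?_)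
      have h0 : 0 ≤ M := (norm_nonneg _).trans (hM x)
      rw [norm_mul, norm_mul, norm_norm, Real.norm_eq_abs, abs_of_nonneg h0, mul_comm]
      exact mul_le_mul_of_nonneg_right (hM x) (norm_nonneg _)
    refine hb.ae_eq ?_
    filter_upwards [hfg] with x hx
    rw [hx]

/-- The operator `H_ε = H ∔ ε V` in `L²(ℝ)`, where `H = -d²/dx² + i sgn x` and the sum is
understood in the sense of forms. -/
def perturbedOperator (V : ℝ → ℂ) (hV : Integrable V) (ε : ℝ) : L2 →ₗ.[ℂ] L2 :=
  (perturbedForm V hV ε).operator (dense_perturbedForm_dom V hV ε)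

/-- `V ∈ L¹(ℝ, (1 + x²) dx)`. -/
def WeightedL1 (V : ℝ → ℂ) : Prop :=
  Integrable (fun x => (1 + x ^ 2 : ℝ) • V x)

theorem WeightedL1.integrable {V : ℝ → ℂ} (hV : WeightedL1 V) : Integrable V := by
  have hc : Continuous (fun x : ℝ => (1 + x ^ 2)⁻¹) :=
    Continuous.inv₀ (by fun_prop) fun x => by positivity
  have h : Integrable (fun x => (1 + x ^ 2 : ℝ)⁻¹ • ((1 + x ^ 2 : ℝ) • V x)) := by
    refine hV.mono (hc.aestronglyMeasurable.smul hV.aestronglyMeasurable) (ae_of_all _ fun x => ?_)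
    rw [norm_smul]
    refine mul_le_of_le_one_left (norm_nonneg _) ?_
    rw [norm_inv, Real.norm_eq_abs, abs_of_pos (by positivity)]
    exact inv_le_one_of_one_le₀ (by nlinarith [sq_nonneg x])
  refine h.congr (ae_of_all _ fun x => ?_)
  have : (1 + x ^ 2 : ℝ) ≠ 0 := by positivity
  simp only [smul_smul, inv_mul_cancel₀ this, one_smul]

/-- The half-strip `[0, ∞) + i (-1, 1)`. -/
def halfStrip : Set ℂ := {z | 0 ≤ z.re ∧ -1 < z.im ∧ z.im < 1}

end HalfLineStep

end

/-! ### Primitives of locally integrable functions and the Leibniz rule. -/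

section AbsolutelyContinuous

/-! An eigenfunction is treated as a solution of the ODE `u'' = (i sgn x - z) u + f` with source `f
= ε V u`. Let `k² = i - z` and `m² = -i - z` with real parts `≥ 0`. On the right half-line the
equation factors as `(d/dx - k)(d/dx + k) u = f`. Square integrability excludes the growing mode,
which fixes `u'(0) + k u(0)` as an integral of `f`; reflection does the same for `-u'(0) + m u(0)`
on the left. Adding the two eliminates `u'(0)` and gives `|k + m| |u(0)| ≤ ‖f‖₁`. Integrating the
remaining first-order equation gives `|u(x)| ≤ |u(0)| + ∫ |y| |f|`, uniformly in `z`
(`halfLine_estimate`, `line_estimate`).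

With `M = sup |u|` one has `|f| ≤ |ε| M |V|`. Smallness of the weighted norm makes `|u(0)|`
comparable to `M`, and then `|k + m| ≤ 2 |ε| ‖V‖₁`. So the perturbation can create an eigenvalue
only where the two exponents nearly cancel.

The rest is algebra (`mem_closure_halfStrip_of_norm_le_one`): `(k + m)(k - m) = 2i` yields `z = (k +
m)⁻² - (k + m)² / 4`, and the sign conditions on the real parts turn small `|k + m|` into large `Re
z` and `|Im z| ≤ 1`.

As `V` is only integrable, `u'` is merely absolutely continuous. Hence the preliminary regularity
theory: the weak form of the eigenvalue equation is converted into integral identities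
(`exists_solution_of_mem_pointSpectrum`). -/

theorem AbsolutelyContinuousOnInterval.of_dist_le {X Y : Type*} [PseudoMetricSpace X]
    [PseudoMetricSpace Y] {f : ℝ → X} {g : ℝ → Y} {a b : ℝ}
    (hg : AbsolutelyContinuousOnInterval g a b) (h : ∀ x y, dist (f x) (f y) ≤ dist (g x) (g y)) :
    AbsolutelyContinuousOnInterval f a b :=
  squeeze_zero (fun _ => Finset.sum_nonneg fun _ _ => dist_nonneg)
    (fun _ => Finset.sum_le_sum fun _ _ => h _ _) hg

theorem MeasureTheory.LocallyIntegrable.intervalIntegrable_real {E : Type*} [NormedAddCommGroup E]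
    {f : ℝ → E} (hf : LocallyIntegrable f) (a b : ℝ) : IntervalIntegrable f volume a b :=
  intervalIntegrable_iff.mpr <|
    (hf.integrableOn_isCompact isCompact_uIcc).mono_set Set.uIoc_subset_uIcc

/-- The increments of the primitive are dominated by those of the primitive of the norm, which
reduces the vector-valued case to the real one. -/
theorem MeasureTheory.LocallyIntegrable.absolutelyContinuousOnInterval_primitive {E : Type*}
    [NormedAddCommGroup E] [NormedSpace ℝ E] {f : ℝ → E} (hf : LocallyIntegrable f) {a b c : ℝ}
    (hc : c ∈ Set.uIcc a b) :
    AbsolutelyContinuousOnInterval (fun x => ∫ t in c..x, f t) a b := by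
  have hi := hf.intervalIntegrable_real
  refine ((hi a b).norm.absolutelyContinuousOnInterval_intervalIntegral hc).of_dist_le
    fun x y => ?_
  rw [dist_eq_norm, dist_eq_norm, intervalIntegral.integral_interval_sub_left (hi _ _) (hi _ _),
    intervalIntegral.integral_interval_sub_left (hi _ _).norm (hi _ _).norm]
  exact intervalIntegral.norm_integral_le_abs_integral_norm

/-- Leibniz rule for the product of a `C¹` function with the primitive of a locally integrable
function. -/
theorem mul_primitive_eq {𝕜 : Type*} [RCLike 𝕜] {p p' F f : ℝ → 𝕜} (hp : ∀ x, HasDerivAt p (p' x) x)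
    (hp' : Continuous p') (hf : LocallyIntegrable f) {c : ℝ}
    (hF : ∀ x, F x = F c + ∫ t in c..x, f t) (x : ℝ) :
    p x * F x = p c * F c + ∫ t in c..x, (p' t * F t + p t * f t) := by
  have hi := hf.intervalIntegrable_real
  have hFa : AbsolutelyContinuousOnInterval F c x :=
    (hf.absolutelyContinuousOnInterval_primitive Set.left_mem_uIcc).of_dist_le fun s t => by
      rw [hF s, hF t]; simp
  have hFc : Continuous F := by
    rw [funext hF]
    exact continuous_const.add (intervalIntegral.continuous_primitive hi c)
  have hpc : Continuous p := continuous_iff_continuousAt.mpr fun x => (hp x).continuousAt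
  have hpd : ContDiff ℝ 1 p := contDiff_one_iff_deriv.mpr
    ⟨fun x => (hp x).differentiableAt, by rwa [funext fun x => (hp x).deriv]⟩
  have hpa : AbsolutelyContinuousOnInterval p c x :=
    hpd.contDiffOn.absolutelyContinuousOnInterval
  have hg : LocallyIntegrable (fun t => p' t * F t + p t * f t) :=
    (hp'.mul hFc).locallyIntegrable.add (hf.continuous_smul hpc)
  have hga := hg.absolutelyContinuousOnInterval_primitive (Set.left_mem_uIcc (a := c) (b := x))
  -- The product minus the claimed primitive is absolutely continuous with derivative zero almost
  -- everywhere, hence constant.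
  obtain ⟨C, hC⟩ := AbsolutelyContinuousOnInterval.const_of_ae_hasDerivAt_zero
    ((hpa.smul hFa).sub hga) (by
      filter_upwards [_root_.LocallyIntegrable.ae_hasDerivAt_integral hf,
        _root_.LocallyIntegrable.ae_hasDerivAt_integral hg] with t h1 h2 _
      have h3 : HasDerivAt F (f t) t := by
        rw [funext hF]; exact (h1 c).const_add _
      simpa using ((hp t).mul h3).sub (h2 c))
  have h1 := hC c Set.left_mem_uIcc
  have h2 := hC x Set.right_mem_uIcc
  simp only [Pi.sub_apply, smul_eq_mul, Pi.mul_apply, intervalIntegral.integral_same,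
    sub_zero] at h1 h2
  rw [h1, ← h2]; ring

end AbsolutelyContinuous

/-! ### Weak derivatives in one dimension. -/

section WeakDerivative

/-- A compactly supported function vanishes outside some `(-R, R)`. -/
theorem HasCompactSupport.exists_abs_bound {E : Type*} [Zero E] {χ : ℝ → E}
    (h : HasCompactSupport χ) : ∃ R > 0, ∀ x, R ≤ |x| → χ x = 0 := by
  obtain ⟨R, hR, h'⟩ := h.isCompact.isBounded.subset_ball_lt 0 0
  refine ⟨R, hR, fun x hx => image_eq_zero_of_notMem_tsupport fun hx' => ?_⟩
  have := h' hx'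
  simp at this
  linarith

theorem integral_eq_intervalIntegral_of_eq_zero {E : Type*} [NormedAddCommGroup E]
    [NormedSpace ℝ E] {g : ℝ → E} {R : ℝ} (hR : 0 < R) (h : ∀ x, R ≤ |x| → g x = 0) :
    ∫ x, g x = ∫ x in (-R)..R, g x := by
  rw [intervalIntegral.integral_of_le (by linarith), setIntegral_eq_integral_of_forall_compl_eq_zero]
  intro x hx
  apply h
  by_contra! hlt
  exact hx ⟨(abs_lt.mp hlt).1, (abs_lt.mp hlt).2.le⟩

theorem integral_deriv_smul_primitive {F f : ℝ → ℂ} (hf : LocallyIntegrable f)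
    (hF : ∀ x, F x = F 0 + ∫ t in (0 : ℝ)..x, f t) {χ : ℝ → ℝ} (hχ : ContDiff ℝ ∞ χ)
    (hc : HasCompactSupport χ) : ∫ x, deriv χ x • F x = - ∫ x, χ x • f x := by
  obtain ⟨R, hR, h0⟩ := hc.exists_abs_bound
  obtain ⟨R', hR', h0'⟩ := hc.deriv.exists_abs_bound
  set S := max R R'
  have hS : 0 < S := lt_max_of_lt_left hR
  have h1 : ∀ x, S ≤ |x| → χ x = 0 := fun x hx => h0 x ((le_max_left _ _).trans hx)
  have h2 : ∀ x, S ≤ |x| → deriv χ x = 0 := fun x hx => h0' x ((le_max_right _ _).trans hx)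
  have hi := hf.intervalIntegrable_real
  have hFc : Continuous F := by
    rw [funext hF]
    exact continuous_const.add (intervalIntegral.continuous_primitive hi 0)
  have hdc : Continuous (deriv χ) := hχ.continuous_deriv (by simp)
  have hp : ∀ x, HasDerivAt (fun x => (χ x : ℂ)) ((deriv χ x : ℝ) : ℂ) x := fun x =>
    ((hχ.differentiable (by simp)) x).hasDerivAt.ofReal_comp
  have hF' : ∀ x, F x = F (-S) + ∫ t in (-S)..x, f t := fun x => by
    rw [hF x, hF (-S), ← intervalIntegral.integral_add_adjacent_intervals (hi 0 (-S)) (hi (-S) x)]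
    ring
  have key := mul_primitive_eq hp (by fun_prop) hf hF' S
  rw [h1 S (by rw [abs_of_pos hS]), h1 (-S) (by rw [abs_neg, abs_of_pos hS])] at key
  rw [integral_eq_intervalIntegral_of_eq_zero hS (fun x hx => by rw [h2 x hx, zero_smul]),
    integral_eq_intervalIntegral_of_eq_zero hS (fun x hx => by rw [h1 x hx, zero_smul])]
  have i2 : IntervalIntegrable (fun t => (χ t : ℂ) * f t) volume (-S) S :=
    (hi _ _).continuousOn_mul (by have := hχ.continuous; fun_prop)
  rw [intervalIntegral.integral_add (Continuous.intervalIntegrable (by fun_prop) _ _) i2] at key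
  simp only [real_smul]
  simp only [ofReal_zero, zero_mul, zero_add] at key
  exact eq_neg_of_add_eq_zero_left key.symm

/-- The primitive started to the left of the support vanishes again to its right exactly because the
total integral is zero. -/
theorem exists_contDiff_deriv_eq {θ : ℝ → ℝ} (hθ : ContDiff ℝ ∞ θ) (hc : HasCompactSupport θ)
    (h0 : ∫ x, θ x = 0) : ∃ χ : ℝ → ℝ, ContDiff ℝ ∞ χ ∧ HasCompactSupport χ ∧ deriv χ = θ := by
  obtain ⟨R, hR, hz⟩ := hc.exists_abs_bound
  have hi : ∀ a b, IntervalIntegrable θ volume a b := fun a b => hθ.continuous.intervalIntegrable a b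
  have hd : ∀ x, HasDerivAt (fun x => ∫ t in (-R)..x, θ t) (θ x) x := fun x =>
    intervalIntegral.integral_hasDerivAt_right (hi _ _)
      hθ.continuous.stronglyMeasurable.stronglyMeasurableAtFilter hθ.continuous.continuousAt
  have hde : deriv (fun x => ∫ t in (-R)..x, θ t) = θ := funext fun x => (hd x).deriv
  refine ⟨fun x => ∫ t in (-R)..x, θ t, ?_, ?_, hde⟩
  · rw [contDiff_infty_iff_deriv, hde]
    exact ⟨fun x => (hd x).differentiableAt, hθ⟩
  · refine HasCompactSupport.intro (isCompact_Icc (a := -R) (b := R)) fun x hx => ?_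
    rcases lt_or_ge x (-R) with h | h
    · apply intervalIntegral.integral_zero_ae
      refine Filter.Eventually.of_forall fun t ht => hz t ?_
      rw [Set.uIoc_of_ge h.le] at ht
      rw [abs_of_nonpos (by linarith [ht.2])]; linarith [ht.2]
    · have h' : R < x := by
        by_contra! h'; exact hx ⟨h, h'⟩
      rw [← intervalIntegral.integral_add_adjacent_intervals (hi (-R) R) (hi R x),
        ← integral_eq_intervalIntegral_of_eq_zero hR hz, h0, zero_add]
      apply intervalIntegral.integral_zero_ae
      refine Filter.Eventually.of_forall fun t ht => hz t ?_
      rw [Set.uIoc_of_le h'.le] at ht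
      exact ht.1.le.trans (le_abs_self t)

/-- The lemma of du Bois-Reymond. -/
theorem ae_eq_const_of_integral_deriv_smul_eq_zero {D : ℝ → ℂ} (hD : LocallyIntegrable D)
    (h : ∀ χ : ℝ → ℝ, ContDiff ℝ ∞ χ → HasCompactSupport χ → ∫ x, deriv χ x • D x = 0) :
    ∃ c : ℂ, ∀ᵐ x, D x = c := by
  let b : ContDiffBump (0 : ℝ) := ⟨1, 2, one_pos, one_lt_two⟩
  set η : ℝ → ℝ := b.normed volume
  have hη : ContDiff ℝ ∞ η := b.contDiff_normed
  have hηc : HasCompactSupport η := b.hasCompactSupport_normed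
  have hη1 : ∫ x, η x = 1 := b.integral_normed
  refine ⟨∫ x, η x • D x, ?_⟩
  refine ae_eq_of_integral_contDiff_smul_eq hD
    (continuous_const.locallyIntegrable) fun φ hφ hφc => ?_
  set a := ∫ x, φ x
  have iφ := hφ.continuous.integrable_of_hasCompactSupport hφc (μ := volume)
  have iη := hη.continuous.integrable_of_hasCompactSupport hηc (μ := volume)
  -- Subtracting `a η`, where `η` has integral one, gives `φ` mean zero, so the difference is an
  -- admissible derivative.
  obtain ⟨χ, h1, h2, h3⟩ := exists_contDiff_deriv_eq (θ := fun x => φ x - a * η x)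
    (hφ.sub (contDiff_const.mul hη)) (hφc.sub hηc.mul_left) (by
      rw [integral_sub iφ (iη.const_mul a), integral_const_mul, hη1, mul_one, sub_self])
  have := h χ h1 h2
  simp only [h3, sub_smul, mul_smul] at this
  rw [integral_sub (hD.integrable_smul_left_of_hasCompactSupport hφ.continuous hφc)
    ((hD.integrable_smul_left_of_hasCompactSupport hη.continuous hηc).fun_smul a),
    integral_smul, sub_eq_zero] at this
  rw [this, integral_smul_const]

/-- A function with a locally integrable weak derivative is a primitive of it. -/
theorem exists_ae_eq_primitive {W F : ℝ → ℂ} (hW : LocallyIntegrable W) (hF : LocallyIntegrable F)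
    (h : ∀ χ : ℝ → ℝ, ContDiff ℝ ∞ χ → HasCompactSupport χ →
      ∫ x, deriv χ x • W x = - ∫ x, χ x • F x) :
    ∃ c : ℂ, ∀ᵐ x, W x = c + ∫ t in (0 : ℝ)..x, F t := by
  set P : ℝ → ℂ := fun x => ∫ t in (0 : ℝ)..x, F t
  have hP : Continuous P := intervalIntegral.continuous_primitive hF.intervalIntegrable_real 0
  obtain ⟨c, hc⟩ := ae_eq_const_of_integral_deriv_smul_eq_zero (D := fun x => W x - P x)
    (hW.sub hP.locallyIntegrable) fun χ hχ hχc => by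
      have hd : Continuous (deriv χ) := hχ.continuous_deriv (by simp)
      simp only [smul_sub]
      rw [integral_sub (hW.integrable_smul_left_of_hasCompactSupport hd hχc.deriv)
        (hP.locallyIntegrable.integrable_smul_left_of_hasCompactSupport hd hχc.deriv), h χ hχ hχc,
        integral_deriv_smul_primitive hF (fun x => by simp [P]) hχ hχc, sub_self]
  exact ⟨c, hc.mono fun x hx => by rw [← hx]; ring⟩

end WeakDerivative

/-! ### Decaying solutions on a half-line. -/

section HalfLine

open Filter Topology

/-- A nonzero limit would keep the integrand bounded away from zero on a set of infinite measure. -/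
theorem eq_zero_of_tendsto_of_integrableOn_norm_sq {B : ℝ → ℂ} {L : ℂ}
    (hB : IntegrableOn (fun x => ‖B x‖ ^ 2) (Set.Ioi 0)) (h : Tendsto B atTop (𝓝 L)) : L = 0 := by
  have : ‖L‖ ^ 2 = 0 := by
    refine IntegrableAtFilter.eq_zero_of_tendsto (l := atTop) (μ := volume)
      ⟨Set.Ioi 0, Ioi_mem_atTop 0, hB⟩ ?_ (h.norm.pow 2)
    intro s hs
    obtain ⟨b, hb⟩ := mem_atTop_sets.1 hs
    rw [← top_le_iff, ← Real.volume_Ici (a := b)]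
    exact measure_mono hb
  simpa using this

/-- Integrating by parts produces the boundary term `x ∫_x^∞ g`, which is at most `∫_x^∞ y g`. This
is where the first moment of the source enters. -/
theorem intervalIntegral_integral_Ioi_le {g : ℝ → ℝ} (hg0 : ∀ x, 0 ≤ g x)
    (hg : Integrable g) (hyg : Integrable fun y => y * g y) (x : ℝ) :
    ∫ s in (0 : ℝ)..x, ∫ y in Set.Ioi s, g y ≤ ∫ y in Set.Ioi 0, y * g y := by
  set a : ℝ → ℝ := fun s => ∫ y in Set.Ioi s, g y
  have ha : ∀ s, a s = a 0 + ∫ t in (0 : ℝ)..s, -g t := fun s => by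
    rw [intervalIntegral.integral_neg, ← sub_eq_add_neg, eq_sub_iff_add_eq, add_comm,
      intervalIntegral.integral_interval_add_Ioi hg.integrableOn hg.integrableOn]
  have hi : ∀ c d, IntervalIntegrable g volume c d := fun c d => hg.intervalIntegrable
  have hac : Continuous a := by
    rw [funext ha]
    exact continuous_const.add (intervalIntegral.continuous_primitive (fun c d => (hi c d).neg) 0)
  have key := mul_primitive_eq (𝕜 := ℝ) (p := fun t => t) (p' := fun _ => 1) (F := a)
    (f := fun t => -g t) (fun x => hasDerivAt_id x) continuous_const hg.neg.locallyIntegrable ha x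
  simp only [one_mul, zero_mul, zero_add, mul_neg] at key
  rw [intervalIntegral.integral_add (hac.intervalIntegrable _ _)
    hyg.fun_neg.intervalIntegrable, intervalIntegral.integral_neg] at key
  have h1 : x * a x ≤ ∫ y in Set.Ioi x, y * g y := by
    rw [← integral_const_mul]
    refine setIntegral_mono_on (hg.integrableOn.const_mul x) hyg.integrableOn measurableSet_Ioi
      fun y hy => mul_le_mul_of_nonneg_right (le_of_lt hy) (hg0 y)
  have h2 := intervalIntegral.integral_interval_add_Ioi (a := 0) (b := x) hyg.integrableOn
    hyg.integrableOn
  linarith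

/-- Square integrable solutions of `u'' = k² u + f` on the half-line, with `u' = v`. -/
theorem halfLine_estimate {k : ℂ} (hk : 0 ≤ k.re) {u v f G : ℝ → ℂ}
    (hu : ∀ x, HasDerivAt u (v x) x) (hG : LocallyIntegrable G)
    (hv : ∀ x, v x = v 0 + ∫ t in (0 : ℝ)..x, G t) (hGf : ∀ᵐ x, 0 < x → G x = k ^ 2 * u x + f x)
    (hu2 : MemLp u 2) (hv2 : MemLp v 2) (hf : Integrable f) (hyf : Integrable fun y => y * ‖f y‖) :
    v 0 + k * u 0 = - ∫ y in Set.Ioi (0 : ℝ), exp (-k * y) * f y ∧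
      ∀ x, 0 ≤ x → ‖u x‖ ≤ ‖u 0‖ + ∫ y in Set.Ioi (0 : ℝ), y * ‖f y‖ := by
  have hvc : Continuous v := by
    rw [funext hv]
    exact continuous_const.add (intervalIntegral.continuous_primitive hG.intervalIntegrable_real 0)
  have huc : Continuous u := continuous_iff_continuousAt.mpr fun x => (hu x).continuousAt
  -- `A = u' + k u` solves the first-order equation `A' = k A + f`.
  set A : ℝ → ℂ := fun x => v x + k * u x with hA
  set g : ℝ → ℂ := fun y => exp (-k * y) * f y with hg
  have hAc : Continuous A := by fun_prop
  have hde : ∀ c : ℂ, ∀ x : ℝ, HasDerivAt (fun x : ℝ => exp (c * x)) (c * exp (c * x)) x :=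
    fun c x => by
      have h := ((ofRealCLM.hasDerivAt (x := x)).const_mul c).cexp
      simpa [mul_comm] using h
  have hne : ∀ c : ℂ, ∀ x : ℝ, ‖exp (c * x)‖ = Real.exp (c.re * x) := fun c x => by
    rw [norm_exp]; simp
  have hgm : AEStronglyMeasurable g := by
    refine AEStronglyMeasurable.mul ?_ hf.aestronglyMeasurable
    exact Continuous.aestronglyMeasurable (by fun_prop)
  have hgle : ∀ x : ℝ, 0 ≤ x → ∀ y ∈ Set.Ioi x, ‖g y‖ ≤ Real.exp (-k.re * x) * ‖f y‖ := by
    intro x _ y hy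
    rw [norm_mul, hne]
    refine mul_le_mul_of_nonneg_right (Real.exp_le_exp.mpr ?_) (norm_nonneg _)
    rw [neg_re]
    nlinarith [hy.out]
  have hgi : IntegrableOn g (Set.Ioi 0) := by
    refine Integrable.mono hf.norm.integrableOn hgm.restrict ?_
    refine (ae_restrict_iff' measurableSet_Ioi).mpr (Eventually.of_forall fun y hy => ?_)
    simpa using hgle 0 le_rfl y hy
  have hB : ∀ x : ℝ, 0 ≤ x → exp (-k * x) * A x = A 0 + ∫ y in (0 : ℝ)..x, g y := by
    intro x hx
    have hGv : LocallyIntegrable (fun x => G x + k * v x) :=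
      hG.add (Continuous.locallyIntegrable (by fun_prop))
    have key := mul_primitive_eq (hde (-k)) (by fun_prop) (F := A) hGv (c := 0) (fun x => by
      have e : k * u x = k * u 0 + ∫ t in (0 : ℝ)..x, k * v t := by
        rw [intervalIntegral.integral_const_mul, intervalIntegral.integral_eq_sub_of_hasDerivAt
          (fun t _ => hu t) (hvc.intervalIntegrable _ _)]
        ring
      rw [intervalIntegral.integral_add (hG.intervalIntegrable_real _ _)
        (Continuous.intervalIntegrable (by fun_prop) _ _)]
      simp only [hA]
      rw [e, hv x]
      ring) x
    rw [key]
    simp only [ofReal_zero, mul_zero, exp_zero, one_mul]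
    congr 1
    apply intervalIntegral.integral_congr_ae
    filter_upwards [hGf] with t ht ht'
    rw [Set.uIoc_of_le hx] at ht'
    rw [ht ht'.1]
    simp only [hA, hg]
    ring
  have hlim : Tendsto (fun x : ℝ => exp (-k * x) * A x) atTop
      (𝓝 (A 0 + ∫ y in Set.Ioi (0 : ℝ), g y)) := by
    refine (tendsto_const_nhds.add (intervalIntegral_tendsto_integral_Ioi 0 hgi tendsto_id)).congr'
      ?_
    filter_upwards [eventually_ge_atTop 0] with x hx
    exact (hB x hx).symm
  have hA2 : Integrable fun x => ‖A x‖ ^ 2 := by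
    have : MemLp A 2 := hv2.add (hu2.const_mul k)
    exact (memLp_two_iff_integrable_sq_norm hAc.aestronglyMeasurable).mp this
  -- Since `|exp (-k x)| ≤ 1` for `x ≥ 0`, even when `Re k = 0`, the function `exp (-k x) A` is
  -- square integrable on the half-line, so its limit vanishes.
  have hzero := eq_zero_of_tendsto_of_integrableOn_norm_sq (B := fun x : ℝ => exp (-k * x) * A x)
    (Integrable.mono hA2.integrableOn (Continuous.aestronglyMeasurable (by fun_prop)) (by
      refine (ae_restrict_iff' measurableSet_Ioi).mpr (Eventually.of_forall fun y hy => ?_)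
      rw [Real.norm_of_nonneg (by positivity), Real.norm_of_nonneg (by positivity), norm_mul, hne]
      refine pow_le_pow_left₀ (by positivity) (mul_le_of_le_one_left (norm_nonneg _) ?_) 2
      rw [Real.exp_le_one_iff, neg_re]
      nlinarith [hy.out])) hlim
  refine ⟨eq_neg_of_add_eq_zero_left hzero, ?_⟩
  -- The vanishing limit expresses `exp (-k x) A x` as a tail integral, whose kernel is at most `exp
  -- (-Re k x)`; this factor cancels.
  have hAle : ∀ x : ℝ, 0 ≤ x → ‖A x‖ ≤ ∫ y in Set.Ioi x, ‖f y‖ := by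
    intro x hx
    have h1 : exp (-k * x) * A x = - ∫ y in Set.Ioi x, g y := by
      rw [hB x hx, eq_neg_iff_add_eq_zero, add_assoc,
        intervalIntegral.integral_interval_add_Ioi hgi (hgi.mono_set (Set.Ioi_subset_Ioi hx)),
        hzero]
    have h2 : ‖exp (-k * x) * A x‖ ≤ ∫ y in Set.Ioi x, Real.exp (-k.re * x) * ‖f y‖ := by
      rw [h1, norm_neg]
      exact norm_integral_le_of_norm_le (hf.norm.const_mul _).integrableOn
        ((ae_restrict_iff' measurableSet_Ioi).mpr (Eventually.of_forall (hgle x hx)))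
    rw [integral_const_mul, norm_mul, hne, neg_re] at h2
    exact le_of_mul_le_mul_left h2 (Real.exp_pos _)
  intro x hx
  -- Second integration, now of `u' + k u = A` with integrating factor `exp (k x)`. Bounding `exp
  -- (Re k s)` by its value at `s = x` and dividing makes the estimate uniform in `k`.
  have hux : exp (k * x) * u x = u 0 + ∫ s in (0 : ℝ)..x, exp (k * s) * A s := by
    have := intervalIntegral.integral_eq_sub_of_hasDerivAt (a := 0) (b := x)
      (fun t _ => (hde k t).mul (hu t)) (Continuous.intervalIntegrable (by fun_prop) _ _)
    simp only [Pi.mul_apply, ofReal_zero, mul_zero, exp_zero, one_mul] at this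
    rw [← sub_eq_iff_eq_add', ← this]
    congr 1
    ext t
    simp only [hA]
    ring
  have hanti : Antitone fun s => ∫ y in Set.Ioi s, ‖f y‖ := fun s t hst =>
    setIntegral_mono_set hf.norm.integrableOn (Eventually.of_forall fun _ => norm_nonneg _)
      (Set.Ioi_subset_Ioi hst).eventuallyLE
  have h3 : ‖∫ s in (0 : ℝ)..x, exp (k * s) * A s‖ ≤
      ∫ s in (0 : ℝ)..x, Real.exp (k.re * x) * ∫ y in Set.Ioi s, ‖f y‖ := by
    refine intervalIntegral.norm_integral_le_of_norm_le hx (Eventually.of_forall fun s hs => ?_)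
      (hanti.intervalIntegrable.const_mul _)
    rw [norm_mul, hne]
    refine mul_le_mul (Real.exp_le_exp.mpr (by nlinarith [hs.2])) (hAle s hs.1.le)
      (norm_nonneg _) (Real.exp_pos _).le
  rw [intervalIntegral.integral_const_mul] at h3
  have h4 := intervalIntegral_integral_Ioi_le (fun x => norm_nonneg (f x)) hf.norm hyf x
  have h5 : 1 ≤ Real.exp (k.re * x) := Real.one_le_exp (by positivity)
  have h6 : Real.exp (k.re * x) * ‖u x‖ ≤
      Real.exp (k.re * x) * (‖u 0‖ + ∫ y in Set.Ioi (0 : ℝ), y * ‖f y‖) := by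
    rw [← hne, ← norm_mul, hux, hne]
    refine (norm_add_le _ _).trans ?_
    rw [mul_add]
    exact add_le_add (le_mul_of_one_le_left (norm_nonneg _) h5)
      (h3.trans (mul_le_mul_of_nonneg_left h4 (Real.exp_pos _).le))
  exact le_of_mul_le_mul_left h6 (Real.exp_pos _)

end HalfLine

/-! ### Matching the two half-lines at the origin. -/

section Line

/-- Square integrable solutions of `u'' = k² u + f` on the right and `u'' = m² u + f` on the left
half-line, with `u' = v`. -/
theorem line_estimate {k m : ℂ} (hk : 0 ≤ k.re) (hm : 0 ≤ m.re) {u v f G : ℝ → ℂ}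
    (hu : ∀ x, HasDerivAt u (v x) x) (hG : LocallyIntegrable G)
    (hv : ∀ x, v x = v 0 + ∫ t in (0 : ℝ)..x, G t) (hGk : ∀ x, 0 < x → G x = k ^ 2 * u x + f x)
    (hGm : ∀ x, x < 0 → G x = m ^ 2 * u x + f x)
    (hu2 : MemLp u 2) (hv2 : MemLp v 2) (hf : Integrable f) (hyf : Integrable fun y => |y| * ‖f y‖) :
    ‖k + m‖ * ‖u 0‖ ≤ ∫ y, ‖f y‖ ∧ ∀ x, ‖u x‖ ≤ ‖u 0‖ + ∫ y, |y| * ‖f y‖ := by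
  have hyf' : Integrable fun y => y * ‖f y‖ := by
    refine hyf.mono (measurable_id.aestronglyMeasurable.mul hf.aestronglyMeasurable.norm)
      (Filter.Eventually.of_forall fun y => ?_)
    simp
  have hGn : LocallyIntegrable fun x => G (-x) := by
    refine locallyIntegrable_iff.mpr fun K hK => ?_
    have h1 : IntegrableOn G (-K) := hG.integrableOn_isCompact hK.neg
    have := (Measure.measurePreserving_neg (volume : Measure ℝ)).integrableOn_comp_preimage
      (Homeomorph.neg ℝ).measurableEmbedding (f := G) (s := -K)
    have h2 := this.mpr h1
    simpa [Function.comp_def] using h2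
  have mp := Measure.measurePreserving_neg (volume : Measure ℝ)
  obtain ⟨e1, b1⟩ := halfLine_estimate hk hu hG hv (Filter.Eventually.of_forall hGk) hu2 hv2 hf hyf'
  -- Reflection: the first derivative changes sign and the second does not.
  obtain ⟨e2, b2⟩ := halfLine_estimate hm (u := fun x => u (-x)) (v := fun x => -v (-x))
    (f := fun x => f (-x)) (G := fun x => G (-x))
    (fun x => by simpa [Function.comp_def] using (hu (-x)).scomp x (hasDerivAt_neg x)) hGn
    (fun x => by
      rw [intervalIntegral.integral_comp_neg, hv (-x), intervalIntegral.integral_symm]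
      simp; ring)
    (Filter.Eventually.of_forall fun x hx => hGm _ (by linarith))
    (hu2.comp_measurePreserving mp) (hv2.comp_measurePreserving mp).neg
    (mp.integrable_comp_of_integrable hf)
    (by simpa [Function.comp_def] using (mp.integrable_comp_of_integrable hyf').neg)
  simp only [neg_zero] at e2 b2
  have hn : ∀ {c : ℂ}, 0 ≤ c.re → ∀ {h : ℝ → ℂ}, Integrable h →
      ‖∫ y in Set.Ioi (0 : ℝ), exp (-c * y) * h y‖ ≤ ∫ y in Set.Ioi (0 : ℝ), ‖h y‖ := by
    intro c hc h hh
    refine norm_integral_le_of_norm_le hh.norm.integrableOn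
      ((ae_restrict_iff' measurableSet_Ioi).mpr (Filter.Eventually.of_forall fun y hy => ?_))
    rw [norm_mul, norm_exp]
    refine mul_le_of_le_one_left (norm_nonneg _) (Real.exp_le_one_iff.mpr ?_)
    have := hy.out
    simp
    positivity
  have split : ∀ {g : ℝ → ℝ}, Integrable g →
      (∫ y in Set.Ioi 0, g y) + ∫ y in Set.Ioi 0, g (-y) = ∫ y, g y := by
    intro g hg
    rw [integral_comp_neg_Ioi, neg_zero, add_comm,
      intervalIntegral.integral_Iic_add_Ioi hg.integrableOn hg.integrableOn]
  have hle : ∀ {g : ℝ → ℝ}, Integrable g → (∀ y, 0 ≤ g y) →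
      (∫ y in Set.Ioi 0, g y) ≤ ∫ y, g y := fun hg h0 =>
    setIntegral_le_integral hg (Filter.Eventually.of_forall h0)
  constructor
  -- Adding the two boundary identities cancels `v 0`.
  · have e : (k + m) * u 0 = -(∫ y in Set.Ioi (0 : ℝ), exp (-k * y) * f y) +
        -(∫ y in Set.Ioi (0 : ℝ), exp (-m * y) * f (-y)) := by
      rw [← e1, ← e2]; ring
    rw [← norm_mul, e, ← split hf.norm]
    refine (norm_add_le _ _).trans ?_
    rw [norm_neg, norm_neg]
    exact add_le_add (hn hk hf) (hn hm (mp.integrable_comp_of_integrable hf))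
  · intro x
    rcases le_total 0 x with hx | hx
    · refine (b1 x hx).trans (add_le_add_right ?_ _)
      refine le_trans (le_of_eq ?_) (hle hyf fun y => by positivity)
      refine setIntegral_congr_fun measurableSet_Ioi fun y hy => ?_
      simp only [abs_of_pos hy.out]
    · have := b2 (-x) (by linarith)
      rw [neg_neg] at this
      refine this.trans (add_le_add_right ?_ _)
      have hi : Integrable fun y => |y| * ‖f (-y)‖ := by
        simpa [Function.comp_def] using mp.integrable_comp_of_integrable hyf
      rw [← integral_neg_eq_self (fun y => |y| * ‖f y‖)]
      simp only [abs_neg]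
      refine le_trans (le_of_eq ?_) (hle hi fun y => by positivity)
      refine setIntegral_congr_fun measurableSet_Ioi fun y hy => ?_
      simp only [abs_of_pos hy.out]

/-- The derivative `2 u v` of `u²` is integrable. This makes the supremum of `|u|` finite, as the
final absorption argument requires. -/
theorem exists_bound_of_memLp_two {u v : ℝ → ℂ} (hu : ∀ x, HasDerivAt u (v x) x)
    (hv : Continuous v) (hu2 : MemLp u 2) (hv2 : MemLp v 2) : ∃ M, ∀ x, ‖u x‖ ≤ M := by
  have huc : Continuous u := continuous_iff_continuousAt.mpr fun x => (hu x).continuousAt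
  have hi : Integrable fun x => v x * u x := hv2.integrable_mul hu2
  refine ⟨Real.sqrt (‖u 0‖ ^ 2 + ∫ x, ‖v x * u x + u x * v x‖), fun x => Real.le_sqrt_of_sq_le ?_⟩
  have key := intervalIntegral.integral_eq_sub_of_hasDerivAt (a := 0) (b := x)
    (fun t _ => (hu t).mul (hu t)) (Continuous.intervalIntegrable (by fun_prop) _ _)
  have h2 : ‖∫ t in (0 : ℝ)..x, (v t * u t + u t * v t)‖ ≤ ∫ x, ‖v x * u x + u x * v x‖ := by
    refine intervalIntegral.norm_integral_le_integral_norm_uIoc.trans ?_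
    refine setIntegral_le_integral ?_ (Filter.Eventually.of_forall fun _ => norm_nonneg _)
    exact (hi.add (by simpa only [mul_comm] using hi)).norm
  rw [key] at h2
  simp only [Pi.mul_apply] at h2
  rw [← norm_pow, sq, ← norm_pow, sq]
  calc ‖u x * u x‖ = ‖u 0 * u 0 + (u x * u x - u 0 * u 0)‖ := by ring_nf
    _ ≤ _ := (norm_add_le _ _).trans (add_le_add_right h2 _)

end Line

/-! ### Algebra of the characteristic exponents. -/

namespace HalfLineStep

theorem exists_sq_eq_re_nonneg (w : ℂ) : ∃ k : ℂ, k ^ 2 = w ∧ 0 ≤ k.re := by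
  obtain ⟨k, hk⟩ := IsAlgClosed.exists_pow_nat_eq w two_pos
  rcases le_total 0 k.re with h | h
  · exact ⟨k, hk, h⟩
  · exact ⟨-k, by rw [neg_sq, hk], by simpa using h⟩

theorem mem_closure_halfStrip {z : ℂ} (h0 : 0 ≤ z.re) (h1 : -1 ≤ z.im) (h2 : z.im ≤ 1) :
    z ∈ closure halfStrip := by
  have : halfStrip = Set.Ici 0 ×ℂ Set.Ioo (-1) 1 := by
    ext w; simp [halfStrip, mem_reProdIm]
  rw [this, closure_reProdIm, closure_Ioo (by norm_num), closure_Ici]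
  exact ⟨h0, h1, h2⟩

/-- Because `k² - m² = 2i`. -/
theorem sum_sqrt_ne_zero {k m z : ℂ} (hk : k ^ 2 = I - z) (hm : m ^ 2 = -I - z) : k + m ≠ 0 := by
  intro h
  have h2 : k ^ 2 - m ^ 2 = 0 := by linear_combination (k - m) * h
  rw [hk, hm] at h2
  have := congrArg im h2
  simp at this

/-- If the two characteristic exponents nearly cancel, then `z` lies far to the right in the
half-strip. -/
theorem mem_closure_halfStrip_of_norm_le_one {k m z : ℂ} (hk : k ^ 2 = I - z)
    (hm : m ^ 2 = -I - z) (hk0 : 0 ≤ k.re) (hm0 : 0 ≤ m.re) (hs : ‖k + m‖ ≤ 1) :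
    z ∈ closure halfStrip ∧ 1 ≤ 4 * ‖k + m‖ ^ 2 * z.re := by
  have hS : ‖k + m‖ ^ 2 = (k.re + m.re) ^ 2 + (k.im + m.im) ^ 2 := by
    rw [Complex.sq_norm, normSq_apply, add_re, add_im]; ring
  have hS1 : ‖k + m‖ ^ 2 ≤ 1 := pow_le_one₀ (norm_nonneg _) hs
  have hSpos : 0 < ‖k + m‖ ^ 2 := by
    have := norm_pos_iff.mpr (sum_sqrt_ne_zero hk hm); positivity
  generalize ‖k + m‖ ^ 2 = S at *
  have e1 := congrArg re hk
  have e2 := congrArg im hk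
  have e3 := congrArg re hm
  have e4 := congrArg im hm
  simp only [sq, mul_re, mul_im, sub_re, sub_im, neg_re, neg_im, I_re, I_im] at e1 e2 e3 e4
  generalize k.re = a at *
  generalize k.im = b at *
  generalize m.re = c at *
  generalize m.im = d at *
  set x := z.re
  -- Nonnegativity of both real parts forces `|Re (k - m)| ≤ Re (k + m) ≤ |k + m|`, so the large
  -- number `k - m` is nearly imaginary.
  have hA : (a - c) ^ 2 ≤ (a + c) ^ 2 := by nlinarith [mul_nonneg hk0 hm0]
  have hP : (a + c) ^ 2 ≤ S := by nlinarith [sq_nonneg (b + d)]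
  -- Real and imaginary parts of `(k + m)(k - m) = 2i`. The next identities are the imaginary part
  -- of `k - m = 2i / (k + m)` and the squared modulus `|k + m|² |k - m|² = 4`.
  have h0 : (a + c) * (a - c) - (b + d) * (b - d) = 0 := by linarith
  have h2 : (a + c) * (b - d) + (b + d) * (a - c) = 2 := by linarith
  have hB : S * (b - d) = 2 * (a + c) := by
    rw [hS]; linear_combination (a + c) * h2 - (b + d) * h0
  have hB0 : 0 ≤ b - d := by
    by_contra! h
    nlinarith
  have h4 : S * ((a - c) ^ 2 + (b - d) ^ 2) = 4 := by
    rw [hS]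
    linear_combination ((a + c) * (a - c) - (b + d) * (b - d)) * h0 +
      ((a + c) * (b - d) + (b + d) * (a - c) + 2) * h2
  -- From `-2z = k² + m²`; the two squares of real parts are at most `S`, so the right side is at
  -- least `4 - 3 S² ≥ 1`.
  have hx : 1 ≤ 4 * S * x := by
    have : 4 * S * x = 4 + S * ((b + d) ^ 2 - (a + c) ^ 2 - 2 * (a - c) ^ 2) := by
      linear_combination h4 + 2 * S * e1 + 2 * S * e3
    rw [this]
    nlinarith [sq_nonneg (b + d)]
  have hBQ : (b + d) ^ 2 ≤ (b - d) ^ 2 := by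
    have : 4 ≤ (a - c) ^ 2 + (b - d) ^ 2 := by
      rw [← h4]
      exact mul_le_of_le_one_left (by positivity) hS1
    linarith
  -- With `b - d ≥ 0` this says `b ≥ 0 ≥ d`, and then `2ab = 1 - Im z` and `2cd = -1 - Im z` confine
  -- `Im z` to `[-1, 1]`.
  have hQB := sq_le_sq.mp hBQ
  rw [abs_of_nonneg hB0] at hQB
  obtain ⟨q1, q2⟩ := abs_le.mp hQB
  have hx0 : 0 ≤ x := by
    by_contra! h
    nlinarith
  exact ⟨mem_closure_halfStrip hx0 (by nlinarith) (by nlinarith), hx⟩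

end HalfLineStep

/-! ### From eigenfunctions to solutions of the differential equation. -/

namespace HalfLineStep

/-- The function `i sgn x`. -/
noncomputable def stepPotential (x : ℝ) : ℂ :=
  (Set.Ioi 0).indicator (fun _ => I) x - (Set.Iio 0).indicator (fun _ => I) x

theorem stepPotential_of_pos {x : ℝ} (hx : 0 < x) : stepPotential x = I := by
  simp [stepPotential, hx, hx.le]

theorem stepPotential_of_neg {x : ℝ} (hx : x < 0) : stepPotential x = -I := by
  simp [stepPotential, hx, hx.le]

theorem locallyIntegrable_stepPotential_mul {g : ℝ → ℂ} (hg : LocallyIntegrable g) :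
    LocallyIntegrable fun x => stepPotential x * g x := by
  have h : ∀ s : Set ℝ, MeasurableSet s → LocallyIntegrable (s.indicator fun x => I * g x) :=
    fun s hs => (hg.smul I).indicator hs
  refine ((h (Set.Ioi 0) measurableSet_Ioi).sub (h (Set.Iio 0) measurableSet_Iio)).congr
    (Filter.Eventually.of_forall fun x => ?_)
  simp only [Pi.sub_apply, stepPotential, sub_mul, Set.indicator_mul_left]

theorem memLp_testFunction {χ : ℝ → ℝ} (hχ : Continuous χ) (hc : HasCompactSupport χ) :
    MemLp (fun x => (χ x : ℂ)) 2 :=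
  (hχ.memLp_of_hasCompactSupport hc).ofReal

theorem isWeakDeriv_testFunction {χ : ℝ → ℝ} (hχ : ContDiff ℝ ∞ χ) (hc : HasCompactSupport χ) :
    IsWeakDeriv (memLp_testFunction hχ.continuous hc).toLp
      (memLp_testFunction (hχ.continuous_deriv (by simp)) hc.deriv).toLp := by
  intro θ hθ hθc
  have cχ : Continuous (fun x => ((deriv χ x : ℝ) : ℂ)) :=
    continuous_ofReal.comp (hχ.continuous_deriv (by simp))
  have e₁ : ∀ w : ℝ → ℝ, ∀ g : ℝ → ℂ, ∀ hg : MemLp g 2,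
      ∫ x, w x • (hg.toLp : L2) x = ∫ x, w x • g x := fun w g hg =>
    integral_congr_ae (hg.coeFn_toLp.mono fun x hx => by simp only [hx])
  rw [e₁, e₁]
  refine integral_deriv_smul_primitive cχ.locallyIntegrable (fun x => ?_) hθ hθc
  rw [intervalIntegral.integral_eq_sub_of_hasDerivAt
    (fun t _ => ((hχ.differentiable (by simp)) t).hasDerivAt.ofReal_comp)
    (cχ.intervalIntegrable _ _)]
  ring

theorem testFunction_mem_W12 {χ : ℝ → ℝ} (hχ : ContDiff ℝ ∞ χ) (hc : HasCompactSupport χ) :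
    (memLp_testFunction hχ.continuous hc).toLp ∈ W12 :=
  ⟨_, isWeakDeriv_testFunction hχ hc⟩

theorem testFunction_mem_potentialDom {V : ℝ → ℂ} (hV : Integrable V) {χ : ℝ → ℝ}
    (hχ : Continuous χ) (hc : HasCompactSupport χ) :
    (memLp_testFunction hχ hc).toLp ∈ potentialDom V := by
  obtain ⟨M, hM⟩ := hc.exists_bound_of_continuous hχ
  have h0 : 0 ≤ M := (norm_nonneg _).trans (hM 0)
  have hm : AEStronglyMeasurable (fun x => (Real.sqrt ‖V x‖ : ℂ)) (volume : Measure ℝ) :=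
    continuous_ofReal.comp_aestronglyMeasurable
      (Real.continuous_sqrt.comp_aestronglyMeasurable hV.aestronglyMeasurable.norm)
  have hs : MemLp (fun x => (Real.sqrt ‖V x‖ : ℂ)) 2 (volume : Measure ℝ) := by
    rw [memLp_two_iff_integrable_sq_norm hm]
    simpa [Real.sq_sqrt, abs_of_nonneg (Real.sqrt_nonneg _)] using hV.norm
  have hb : MemLp (fun x => (Real.sqrt ‖V x‖ : ℂ) * (χ x : ℂ)) 2 (volume : Measure ℝ) := by
    refine (hs.norm.const_mul M).mono
      (hm.mul (continuous_ofReal.comp hχ).aestronglyMeasurable)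
      (Filter.Eventually.of_forall fun x => ?_)
    rw [norm_mul, norm_mul, norm_norm, Real.norm_eq_abs, abs_of_nonneg h0, mul_comm, norm_real]
    exact mul_le_mul_of_nonneg_right (hM x) (norm_nonneg _)
  refine hb.ae_eq ?_
  filter_upwards [(memLp_testFunction hχ hc).coeFn_toLp] with x hx
  rw [hx]

/-- The eigenvalue equation in its weak form, for real test functions. -/
theorem weak_eigenvalue_equation {V : ℝ → ℂ} {hV : Integrable V} {ε : ℝ} {z : ℂ}
    {ψ : (perturbedOperator V hV ε).domain}
    (h : perturbedOperator V hV ε ψ = z • (ψ : L2)) :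
    ∃ hψ : (ψ : L2) ∈ W12, ∀ χ : ℝ → ℝ, ContDiff ℝ ∞ χ → HasCompactSupport χ →
      (∫ x, deriv χ x • weakDeriv ⟨ψ, hψ⟩ x) + (I * (∫ x in Set.Ioi 0, χ x • (ψ : L2) x)
        - I * ∫ x in Set.Iio 0, χ x • (ψ : L2) x) + ε * (∫ x, χ x • (V x * (ψ : L2) x))
        = z * ∫ x, χ x • (ψ : L2) x := by
  have hψd := SesqForm.mem_dom_of_mem_operatorDom (t := perturbedForm V hV ε) ψ
  refine ⟨hψd.1, fun χ hχ hc => ?_⟩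
  have key := SesqForm.inner_operatorVal (t := perturbedForm V hV ε) ψ
    ⟨_, testFunction_mem_W12 hχ hc, testFunction_mem_potentialDom hV hχ.continuous hc⟩
  have h' : (perturbedForm V hV ε).operatorVal ψ = z • (ψ : L2) := h
  rw [h', inner_smul_right] at key
  -- `weakDeriv` is a choice; uniqueness identifies it with the classical derivative of the test
  -- function.
  have hd : weakDeriv ⟨_, testFunction_mem_W12 hχ hc⟩ = _ :=
    (Exists.choose_spec (testFunction_mem_W12 hχ hc)).unique (isWeakDeriv_testFunction hχ hc)
  have hin : ∀ (θ : ℝ → ℝ) (hθ : MemLp (fun x => (θ x : ℂ)) 2) (g : L2),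
      inner ℂ (hθ.toLp : L2) g = ∫ x, θ x • g x := fun θ hθ g => by
    rw [L2.inner_def]
    refine integral_congr_ae (hθ.coeFn_toLp.mono fun x hx => ?_)
    simp only [hx]
    simp [mul_comm]
  have hfun : ∀ (W g : ℝ → ℂ) (s : Set ℝ), ∫ x in s, W x * g x *
      conj (((memLp_testFunction hχ.continuous hc).toLp : L2) x) = ∫ x in s, χ x • (W x * g x) :=
    fun W g s => by
      refine integral_congr_ae (ae_restrict_of_ae
        ((memLp_testFunction hχ.continuous hc).coeFn_toLp.mono fun x hx => ?_))
      simp only [hx]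
      simp [mul_comm]
  have expand : (perturbedForm V hV ε).form ⟨ψ, hψd⟩
      ⟨_, testFunction_mem_W12 hχ hc, testFunction_mem_potentialDom hV hχ.continuous hc⟩ =
      (inner ℂ (weakDeriv ⟨_, testFunction_mem_W12 hχ hc⟩) (weakDeriv ⟨ψ, hψd.1⟩) +
      (I * (∫ x in Set.Ioi 0, (ψ : L2) x *
          conj (((memLp_testFunction hχ.continuous hc).toLp : L2) x)) -
        I * (∫ x in Set.Iio 0, (ψ : L2) x *
          conj (((memLp_testFunction hχ.continuous hc).toLp : L2) x)))) +
      ε * ∫ x, V x * (ψ : L2) x *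
          conj (((memLp_testFunction hχ.continuous hc).toLp : L2) x) := rfl
  rw [expand, hd, hin, hin] at key
  have h1 := hfun (fun _ => 1) (ψ : L2)
  have h2 := hfun V (ψ : L2) Set.univ
  simp only [one_mul] at h1
  simp only [Measure.restrict_univ] at h2
  rw [h1, h1, h2] at key
  exact key.symm

/-- An eigenfunction is a continuously differentiable, square integrable solution of the
eigenvalue equation, whose derivative is absolutely continuous. -/
theorem exists_solution_of_mem_pointSpectrum {V : ℝ → ℂ} {hV : Integrable V} {ε : ℝ} {z : ℂ}
    (hz : z ∈ pointSpectrum (perturbedOperator V hV ε)) :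
    ∃ u v : ℝ → ℂ, (∃ x, u x ≠ 0) ∧ (∀ x, HasDerivAt u (v x) x) ∧ MemLp u 2 ∧ MemLp v 2 ∧
      LocallyIntegrable (fun x => (stepPotential x - z) * u x + ε * V x * u x) ∧
      ∀ x, v x = v 0 + ∫ t in (0 : ℝ)..x, ((stepPotential t - z) * u t + ε * V t * u t) := by
  obtain ⟨ψ, hψ0, hψ⟩ := hz
  obtain ⟨hW, hweak⟩ := weak_eigenvalue_equation hψ
  set g : L2 := weakDeriv ⟨ψ, hW⟩
  have hg : IsWeakDeriv ψ g := hW.choose_spec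
  have li : ∀ f : L2, LocallyIntegrable f := fun f => (Lp.memLp f).locallyIntegrable (by norm_num)
  obtain ⟨c, hc⟩ := exists_ae_eq_primitive (li ψ) (li g) hg
  set u : ℝ → ℂ := fun x => c + ∫ t in (0 : ℝ)..x, g t
  have huc : Continuous u :=
    continuous_const.add (intervalIntegral.continuous_primitive (li g).intervalIntegrable_real 0)
  have hS := locallyIntegrable_stepPotential_mul huc.locallyIntegrable
  have hVu : LocallyIntegrable fun x => V x * u x := by
    simpa only [smul_eq_mul, mul_comm] using hV.locallyIntegrable.continuous_smul huc
  have hG : LocallyIntegrable (fun x => (stepPotential x - z) * u x + ε * V x * u x) := by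
    refine ((hS.sub (huc.locallyIntegrable.smul z)).add (hVu.smul (ε : ℂ))).congr
      (Filter.Eventually.of_forall fun x => ?_)
    simp only [Pi.add_apply, Pi.sub_apply, Pi.smul_apply, smul_eq_mul]
    ring
  -- The weak equation says that `g` itself has the locally integrable weak derivative `(i sgn x -
  -- z) u + ε V u`, so it too is a primitive almost everywhere.
  obtain ⟨c', hc'⟩ := exists_ae_eq_primitive (li g) hG fun χ hχ hχc => by
    have h := hweak χ hχ hχc
    have ti : ∀ {f : ℝ → ℂ}, LocallyIntegrable f → Integrable fun x => χ x • f x := fun hf =>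
      hf.integrable_smul_left_of_hasCompactSupport hχ.continuous hχc
    have e1 : ∀ s : Set ℝ, ∫ x in s, χ x • (ψ : L2) x = ∫ x in s, χ x • u x := fun s =>
      integral_congr_ae (ae_restrict_of_ae (hc.mono fun x hx => by simp only [hx, u]))
    have e2 : ∫ x, χ x • (V x * (ψ : L2) x) = ∫ x, χ x • (V x * u x) :=
      integral_congr_ae (hc.mono fun x hx => by simp only [hx, u])
    have e3 := e1 Set.univ
    simp only [Measure.restrict_univ] at e3
    rw [e1, e1, e2, e3] at h
    have iu := ti huc.locallyIntegrable
    have e4 : ∫ x, χ x • (stepPotential x * u x) =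
        I * (∫ x in Set.Ioi 0, χ x • u x) - I * ∫ x in Set.Iio 0, χ x • u x := by
      rw [← integral_const_mul, ← integral_const_mul, ← integral_indicator measurableSet_Ioi,
        ← integral_indicator measurableSet_Iio, ← integral_sub
          ((iu.const_mul I).indicator measurableSet_Ioi)
          ((iu.const_mul I).indicator measurableSet_Iio)]
      refine integral_congr_ae (Filter.Eventually.of_forall fun x => ?_)
      simp only [stepPotential, Set.indicator_apply, real_smul]
      split_ifs <;> ring
    have e5 : ∫ x, χ x • ((stepPotential x - z) * u x + ε * V x * u x) =
        (∫ x, χ x • (stepPotential x * u x)) - z * (∫ x, χ x • u x)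
          + ε * ∫ x, χ x • (V x * u x) := by
      rw [← integral_const_mul, ← integral_const_mul, ← integral_sub (ti hS) (iu.const_mul z),
        ← integral_add (f := fun x => χ x • (stepPotential x * u x) - z * χ x • u x)
          ((ti hS).sub (iu.const_mul z)) ((ti hVu).const_mul _)]
      refine integral_congr_ae (Filter.Eventually.of_forall fun x => ?_)
      simp only [real_smul]
      ring
    rw [e5, e4]
    linear_combination h
  set v : ℝ → ℂ := fun x => c' + ∫ t in (0 : ℝ)..x, ((stepPotential t - z) * u t + ε * V t * u t)
  have hvc : Continuous v :=
    continuous_const.add (intervalIntegral.continuous_primitive hG.intervalIntegrable_real 0)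
  have huv : ∀ x, u x = c + ∫ t in (0 : ℝ)..x, v t := fun x => by
    simp only [u]
    congr 1
    exact intervalIntegral.integral_congr_ae (hc'.mono fun t ht _ => ht)
  refine ⟨u, v, ?_, fun x => ?_, (Lp.memLp (ψ : L2)).ae_eq hc, (Lp.memLp g).ae_eq hc', hG,
    fun x => by simp [v]⟩
  · by_contra! h
    exact hψ0 ((Lp.eq_zero_iff_ae_eq_zero).mpr (hc.mono fun x hx => hx.trans (h x)))
  · rw [funext huv]
    exact (intervalIntegral.integral_hasDerivAt_right (hvc.intervalIntegrable _ _)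
      hvc.stronglyMeasurable.stronglyMeasurableAtFilter hvc.continuousAt).const_add _

end HalfLineStep

/-! ### The a priori estimate and the conclusion. -/

open HalfLineStep
theorem theorem3 :
    ∃ C₁ C₂ : ℝ, 0 < C₁ ∧ 0 < C₂ ∧
      ∀ (V : ℝ → ℂ) (hV : WeightedL1 V) (ε : ℝ),
        |ε| * (∫ x, (1 + x ^ 2) * ‖V x‖) ≤ 1 / C₁ →
          ∀ z ∈ pointSpectrum (perturbedOperator V hV.integrable ε),
            z ∈ closure halfStrip ∧ C₂ ≤ ε ^ 2 * (∫ x, ‖V x‖) ^ 2 * z.re := by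
  -- `1/16` combines `1 ≤ 4 s² Re z` with `s² ≤ 4 ε² ‖V‖₁²`, where `s = |k + m|`; `4` is small
  -- enough a threshold to give `s ≤ 1`.
  refine ⟨4, 1 / 16, by norm_num, by norm_num, fun V hV ε hε z hz => ?_⟩
  obtain ⟨u, v, ⟨x₀, hx₀⟩, hu, hu2, hv2, hG, hv⟩ := exists_solution_of_mem_pointSpectrum hz
  obtain ⟨k, hk, hk0⟩ := exists_sq_eq_re_nonneg (I - z)
  obtain ⟨m, hm, hm0⟩ := exists_sq_eq_re_nonneg (-I - z)
  have hV1 := hV.integrable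
  have hV2 : Integrable fun x => (1 + x ^ 2) * ‖V x‖ := by
    refine hV.norm.congr (Filter.Eventually.of_forall fun x => ?_)
    simp only [norm_smul, Real.norm_eq_abs, abs_of_pos (show (0 : ℝ) < 1 + x ^ 2 by positivity)]
  -- Only the first moment of `V` is needed; the weight `1 + y²` controls it.
  have hy : ∀ y : ℝ, |y| ≤ (1 + y ^ 2) / 2 := fun y => by
    nlinarith [sq_nonneg (|y| - 1), sq_abs y]
  have hVy : Integrable fun y => |y| * ‖V y‖ := by
    refine (hV2.const_mul (1 / 2)).mono
      (continuous_abs.aestronglyMeasurable.mul hV1.aestronglyMeasurable.norm)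
      (Filter.Eventually.of_forall fun y => ?_)
    rw [Real.norm_of_nonneg (by positivity), Real.norm_of_nonneg (by positivity)]
    nlinarith [mul_le_mul_of_nonneg_right (hy y) (norm_nonneg (V y))]
  have hvc : Continuous v := by
    rw [funext hv]
    exact continuous_const.add (intervalIntegral.continuous_primitive hG.intervalIntegrable_real 0)
  have huc : Continuous u := continuous_iff_continuousAt.mpr fun x => (hu x).continuousAt
  obtain ⟨M₀, hM₀⟩ := exists_bound_of_memLp_two hu hvc hu2 hv2
  have hbdd : BddAbove (Set.range fun x => ‖u x‖) := ⟨M₀, by rintro _ ⟨x, rfl⟩; exact hM₀ x⟩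
  set M := ⨆ x, ‖u x‖
  have hM : ∀ x, ‖u x‖ ≤ M := fun x => le_ciSup hbdd x
  have hMpos : 0 < M := (norm_pos_iff.mpr hx₀).trans_le (hM x₀)
  set f : ℝ → ℂ := fun x => ε * V x * u x with hf
  have hfm : AEStronglyMeasurable f :=
    (hV1.aestronglyMeasurable.const_mul _).mul huc.aestronglyMeasurable
  have hfle : ∀ x, ‖f x‖ ≤ |ε| * M * ‖V x‖ := fun x => by
    rw [norm_mul, norm_mul, norm_real, Real.norm_eq_abs, mul_right_comm]
    gcongr
    exact hM x
  have hyfle : ∀ y : ℝ, |y| * ‖f y‖ ≤ |ε| * M * (|y| * ‖V y‖) := fun y =>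
    (mul_le_mul_of_nonneg_left (hfle y) (abs_nonneg y)).trans_eq (by ring)
  have hfi : Integrable f := (hV1.norm.const_mul (|ε| * M)).mono' hfm
    (Filter.Eventually.of_forall hfle)
  have hyf : Integrable fun y => |y| * ‖f y‖ := by
    refine (hVy.const_mul (|ε| * M)).mono'
      (continuous_abs.aestronglyMeasurable.mul hfm.norm) (Filter.Eventually.of_forall fun y => ?_)
    rw [Real.norm_of_nonneg (by positivity)]
    exact hyfle y
  obtain ⟨h1, h2⟩ := line_estimate hk0 hm0 hu hG hv
    (fun x hx => by rw [stepPotential_of_pos hx, hk])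
    (fun x hx => by rw [stepPotential_of_neg hx, hm]) hu2 hv2 hfi hyf
  set N₁ := ∫ x, ‖V x‖
  set N₂ := ∫ x, (1 + x ^ 2) * ‖V x‖
  have hN0 : 0 ≤ N₁ := integral_nonneg fun x => norm_nonneg _
  have hN : N₁ ≤ N₂ := integral_mono hV1.norm hV2 fun x =>
    le_mul_of_one_le_left (norm_nonneg _) (by nlinarith [sq_nonneg x])
  have hI1 : ∫ x, ‖f x‖ ≤ |ε| * M * N₁ := by
    rw [← integral_const_mul]
    exact integral_mono hfi.norm (hV1.norm.const_mul _) hfle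
  have hI2 : ∫ y, |y| * ‖f y‖ ≤ |ε| * M * (N₂ / 2) := by
    refine (integral_mono hyf (hVy.const_mul _) hyfle).trans ?_
    rw [integral_const_mul]
    refine mul_le_mul_of_nonneg_left ?_ (by positivity)
    rw [← integral_div]
    refine integral_mono hVy (hV2.div_const 2) fun y => ?_
    have := mul_le_mul_of_nonneg_right (hy y) (norm_nonneg (V y))
    simp only
    linarith
  set s := ‖k + m‖
  have hs : 0 < s := norm_pos_iff.mpr (sum_sqrt_ne_zero hk hm)
  have hsup : M ≤ ‖u 0‖ + |ε| * M * (N₂ / 2) := ciSup_le fun x => (h2 x).trans (by gcongr)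
  have hsmall : s ≤ 2 * (|ε| * N₁) := by
    -- Since `|ε| N₂ ≤ 1/4`, the source term in `hsup` is at most `M / 8` and is absorbed.
    have e1 : M * (7 / 8) ≤ ‖u 0‖ := by nlinarith
    have e2 : M * (s * (7 / 8)) ≤ M * (|ε| * N₁) := by
      nlinarith [mul_le_mul_of_nonneg_left e1 hs.le]
    have := le_of_mul_le_mul_left e2 hMpos
    linarith
  have hs1 : s ≤ 1 := by
    have := mul_le_mul_of_nonneg_left hN (abs_nonneg ε)
    linarith
  obtain ⟨hstrip, hre⟩ := mem_closure_halfStrip_of_norm_le_one hk hm hk0 hm0 hs1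
  refine ⟨hstrip, ?_⟩
  have hz0 : 0 ≤ z.re := by
    by_contra! h
    nlinarith [sq_pos_of_pos hs]
  have hsq : s ^ 2 ≤ 4 * (ε ^ 2 * N₁ ^ 2) := by
    calc s ^ 2 ≤ (2 * (|ε| * N₁)) ^ 2 := pow_le_pow_left₀ hs.le hsmall 2
      _ = _ := by rw [mul_pow, mul_pow, sq_abs]; norm_num
  nlinarith [mul_le_mul_of_nonneg_right hsq hz0]
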